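/- Let $n\ge 2$, let $\mathcal B\subset\mathbf R^{n^2}$ be the Birkhoff polytope (the set of doubly stochastic $n\times n$ matrices, regarded as vectors of dimension $n^2$ with the Euclidean norm), and let $\mathcal P\subset\{0,1\}^{n^2}$ be the set of permutation matrices, i.e. the extreme points of $\mathcal B$. Let $M=\max_{x,y\in\mathcal B}\|x-y\|_2$ be the diameter of $\mathcal B$, and let $\lambda$ be its pyramidal width, $$\lambda=\min_{K,\;x,\;r}\ \ \min_{S\in\mathcal S_x(K)}\ \ \max_{s\in K\cap\mathcal P,\ v\in S}\Big\langle \frac{r}{\|r\|_2},\,s-v\Big\rangle ,$$ where the first minimum is over all faces $K$ of $\mathcal B$ (including $\mathcal B$ itself), all $x\in K$ and all $r\in\operatorname{cone}(K-x)\setminus\{0\}$, and where $\mathcal S_x(K)$ is the collection of all $S\subseteq K\cap\mathcal P$ such that $x$ is a convex combination of the elements of $S$ with all weights strictly positive. Then $M=\sqrt{2n}$, $\lambda\ge 1/n$, and the eccentricity of $\mathcal B$ satisfies $$\Big(\frac{\lambda}{M}\Big)^2\ \ge\ \frac{1}{2n^3}.$$ -/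

import Mathlib

noncomputable section

namespace BirkhoffEcc

section PyramidalWidth

variable {E : Type*} [NormedAddCommGroup E] [InnerProductSpace ℝ E]

/-- `x` is a proper convex combination of all the elements of the finite set `S`:
every element of `S` receives a strictly positive weight. -/
def IsProperConvexComb (S : Finset E) (x : E) : Prop :=
  ∃ w : E → ℝ, (∀ v ∈ S, 0 < w v) ∧ ∑ v ∈ S, w v = 1 ∧ ∑ v ∈ S, w v • v = x

/-- The number `max_{s ∈ A, v ∈ S} ⟨r / ‖r‖, s - v⟩`, the width in direction `r` of the pyramid with
base `S` and with summit an element of `A` that maximizes `⟨r, ·⟩`. It is used for finite `A`, so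
that the supremum is a maximum. -/
def pyramidDirWidth (A : Set E) (S : Finset E) (r : E) : ℝ :=
  sSup {a : ℝ | ∃ s ∈ A, ∃ v ∈ S, a = inner ℝ (‖r‖⁻¹ • r) (s - v)}

/-- The pyramidal directional width of the finite set of atoms `A` in direction `r` with base
point `x`: the minimum of the widths `pyramidDirWidth A S r` over the sets `S ⊆ A` of which `x` is a
proper convex combination. -/
def pyramidalDirWidth (A : Set E) (r x : E) : ℝ :=
  sInf {a : ℝ | ∃ S : Finset E, (S : Set E) ⊆ A ∧ IsProperConvexComb S x ∧
    a = pyramidDirWidth A S r}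

/-- `r` is a nonzero element of `cone (K - x)`, where `K` is a convex set with `x ∈ K`. -/
def IsFeasibleDir (K : Set E) (x r : E) : Prop :=
  r ≠ 0 ∧ ∃ t : ℝ, 0 ≤ t ∧ ∃ y ∈ K, r = t • (y - x)

/-- The pyramidal width of the finite set of atoms `A` (equivalently, of the polytope `conv A`):
the minimum of the pyramidal directional widths of `K ∩ A` in direction `r` with base point `x`,
over all faces `K` of `conv A` (`conv A` included), all `x ∈ K` and all nonzero
`r ∈ cone (K - x)`. -/
def pyramidalWidth (A : Set E) : ℝ :=
  sInf {a : ℝ | ∃ K : Set E, IsExposed ℝ (convexHull ℝ A) K ∧ ∃ x ∈ K, ∃ r : E,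
    IsFeasibleDir K x r ∧ a = pyramidalDirWidth (K ∩ A) r x}

end PyramidalWidth

/-- An `n × n` real matrix as a vector of the Euclidean space of dimension `n ^ 2`. -/
def vectorize {n : ℕ} (X : Matrix (Fin n) (Fin n) ℝ) : EuclideanSpace ℝ (Fin n × Fin n) :=
  WithLp.toLp 2 (fun e => X e.1 e.2)

/-- The Birkhoff polytope: the vectorized doubly stochastic `n × n` matrices. -/
def birkhoffPolytope (n : ℕ) : Set (EuclideanSpace ℝ (Fin n × Fin n)) :=
  vectorize '' (doublyStochastic ℝ (Fin n) : Set (Matrix (Fin n) (Fin n) ℝ))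

/-- The vectorized `n × n` permutation matrices, the extreme points of the Birkhoff polytope. -/
def permVectors (n : ℕ) : Set (EuclideanSpace ℝ (Fin n × Fin n)) :=
  Set.range fun σ : Equiv.Perm (Fin n) => vectorize (σ.permMatrix ℝ)

end BirkhoffEcc

end

/-!
Write the Birkhoff polytope as `{x ∈ F | 0 ≤ x}` with `F` an affine subspace; its faces have the
same form. Let `x = ∑ wₖ pₖ` and `y` lie in such a polytope, and lower the weights `w` to weights
`a` of maximal total mass with `∑ aₖ pₖ ≤ y`. The remainder `y - ∑ aₖ pₖ` is a multiple of a point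
`z` of the polytope, so that `y - x = ∑ (wₖ - aₖ) (z - pₖ)`. By maximality, each `pₖ` whose weight
was lowered has an entry at least `1` at a position where the constraint is tight, and summing over
these positions bounds `∑ (wₖ - aₖ)` by the `ℓ¹` norm of `y - x`, hence by `√d ‖y - x‖` in
dimension `d`. Taking the inner product with `y - x` yields `‖y - x‖ ≤ √d ⟪y - x, z - pₖ⟫` for the
vertex `pₖ` that minimizes `⟪y - x, ·⟫`. Here `d = n²`.
-/

namespace BirkhoffEcc

open scoped Topology

section Faces

variable {E : Type*} [NormedAddCommGroup E] [InnerProductSpace ℝ E] {A C K : Set E}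
  {S : Finset E} {x : E}

lemma exists_isProperConvexComb (hx : x ∈ convexHull ℝ A) :
    ∃ S : Finset E, (S : Set E) ⊆ A ∧ IsProperConvexComb S x := by
  rw [convexHull_eq_union_convexHull_finite_subsets] at hx
  simp only [Set.mem_iUnion] at hx
  obtain ⟨T, hTA, hxT⟩ := hx
  obtain ⟨w, hw, hw1, hwx⟩ := Finset.mem_convexHull'.1 hxT
  have hpos : ∀ v ∈ T, w v ≠ 0 → 0 < w v := fun v hv h => (hw v hv).lt_of_ne' h
  refine ⟨{v ∈ T | 0 < w v}, fun v hv => hTA (Finset.mem_filter.1 hv).1, w,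
    fun v hv => (Finset.mem_filter.1 hv).2, ?_, ?_⟩
  · rwa [Finset.sum_filter_of_ne hpos]
  · rwa [Finset.sum_filter_of_ne fun v hv h => hpos v hv (left_ne_zero_of_smul h)]

lemma IsProperConvexComb.mem_convexHull (hx : IsProperConvexComb S x) :
    x ∈ convexHull ℝ (S : Set E) := by
  obtain ⟨w, hw, hw1, hwx⟩ := hx
  exact Finset.mem_convexHull'.2 ⟨w, fun v hv => (hw v hv).le, hw1, hwx⟩

lemma IsProperConvexComb.subset_of_isExposed (hx : IsProperConvexComb S x)
    (hK : IsExposed ℝ C K) (hSC : (S : Set E) ⊆ C) (hxK : x ∈ K) : (S : Set E) ⊆ K := by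
  obtain ⟨w, hw, hw1, rfl⟩ := hx
  obtain ⟨l, rfl⟩ := hK ⟨_, hxK⟩
  set x := ∑ v ∈ S, w v • v with hx
  have hgap : ∑ v ∈ S, w v * (l x - l v) = 0 := by
    simp only [mul_sub, Finset.sum_sub_distrib, ← Finset.sum_mul, hw1, one_mul]
    rw [hx, map_sum]
    simp only [map_smul, smul_eq_mul, sub_self]
  have hterm := (Finset.sum_eq_zero_iff_of_nonneg fun v hv =>
    mul_nonneg (hw v hv).le (sub_nonneg.2 (hxK.2 v (hSC hv)))).1 hgap
  intro v hv
  have hlv : l x = l v :=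
    sub_eq_zero.1 ((mul_eq_zero.1 (hterm v hv)).resolve_left (hw v hv).ne')
  exact ⟨hSC hv, fun u hu => (hxK.2 u hu).trans hlv.le⟩

lemma subset_convexHull_inter_of_isExposed (hK : IsExposed ℝ (convexHull ℝ A) K) :
    K ⊆ convexHull ℝ (K ∩ A) := fun x hx => by
  obtain ⟨S, hSA, hSx⟩ := exists_isProperConvexComb (hK.subset hx)
  have hSK := hSx.subset_of_isExposed hK (hSA.trans (subset_convexHull ℝ A)) hx
  exact convexHull_mono (Set.subset_inter hSK hSA) hSx.mem_convexHull

end Faces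

section PyramidalWidth

variable {E : Type*} [NormedAddCommGroup E] [InnerProductSpace ℝ E] {A : Set E} {S : Finset E}

lemma pyramidDirWidth_smul {t : ℝ} (ht : 0 < t) (A : Set E) (S : Finset E) (r : E) :
    pyramidDirWidth A S (t • r) = pyramidDirWidth A S r := by
  have hdir : ‖t • r‖⁻¹ • t • r = ‖r‖⁻¹ • r := by
    rw [norm_smul_of_nonneg ht.le, smul_smul, mul_inv_rev, inv_mul_cancel_right₀ ht.ne']
  simp only [pyramidDirWidth, hdir]

lemma inner_sub_le_norm_mul_pyramidDirWidth (hA : A.Finite) {z v : E}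
    (hz : z ∈ convexHull ℝ A) (hv : v ∈ S) (r : E) :
    inner ℝ r (z - v) ≤ ‖r‖ * pyramidDirWidth A S r := by
  obtain ⟨s, hs, hzs : inner ℝ r z ≤ inner ℝ r s⟩ := ((innerSL ℝ r).toLinearMap.convexOn
    (convex_convexHull ℝ A)).exists_ge_of_mem_convexHull (subset_convexHull ℝ A) hz
  have hbdd : BddAbove {a : ℝ | ∃ s ∈ A, ∃ v ∈ S, a = inner ℝ (‖r‖⁻¹ • r) (s - v)} := by
    refine ((hA.image2 (fun s v => inner ℝ (‖r‖⁻¹ • r) (s - v))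
      S.finite_toSet).subset ?_).bddAbove
    rintro _ ⟨s, hs, v, hv, rfl⟩
    exact Set.mem_image2_of_mem hs hv
  calc inner ℝ r (z - v) ≤ inner ℝ r (s - v) := by
        simpa only [inner_sub_right] using sub_le_sub_right hzs _
    _ = ‖r‖ * inner ℝ (‖r‖⁻¹ • r) (s - v) := by
        rcases eq_or_ne r 0 with rfl | hr
        · simp
        · rw [real_inner_smul_left, mul_inv_cancel_left₀ (norm_ne_zero_iff.2 hr)]
    _ ≤ ‖r‖ * pyramidDirWidth A S r :=
        mul_le_mul_of_nonneg_left (le_csSup hbdd ⟨s, hs, v, hv, rfl⟩) (norm_nonneg r)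

lemma le_pyramidalWidth (hA : A.Nontrivial) {c : ℝ}
    (h : ∀ K, IsExposed ℝ (convexHull ℝ A) K → ∀ x ∈ K, ∀ y ∈ K, x ≠ y →
      ∀ S : Finset E, (S : Set E) ⊆ K ∩ A → IsProperConvexComb S x →
        c ≤ pyramidDirWidth (K ∩ A) S (y - x)) :
    c ≤ pyramidalWidth A := by
  refine le_csInf ?nonempty ?bound
  -- In `ℝ`, `sInf ∅ = 0`: both infima need a competitor before a bound on all of them counts.
  case nonempty =>
    obtain ⟨x, hx, y, hy, hxy⟩ := hA
    exact ⟨_, _, IsExposed.refl _, x, subset_convexHull ℝ A hx, y - x,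
      ⟨sub_ne_zero.2 hxy.symm, 1, zero_le_one, y, subset_convexHull ℝ A hy, by simp⟩, rfl⟩
  case bound =>
    rintro _ ⟨K, hK, x, hx, r, ⟨hr, t, ht, y, hy, rfl⟩, rfl⟩
    obtain ⟨ht0, hyx⟩ := smul_ne_zero_iff.1 hr
    refine le_csInf ?_ ?_
    · obtain ⟨S, hS, hSx⟩ :=
        exists_isProperConvexComb (subset_convexHull_inter_of_isExposed hK hx)
      exact ⟨_, S, hS, hSx, rfl⟩
    · rintro _ ⟨S, hS, hSx, rfl⟩
      rw [pyramidDirWidth_smul (ht.lt_of_ne' ht0)]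
      exact h K hK x hx y hy (sub_ne_zero.1 hyx).symm S hS hSx

end PyramidalWidth

section MaximalSubweights

variable {ι κ : Type*} [Fintype κ] {f : κ → ι → ℝ} {w : κ → ℝ} {y : ι → ℝ}

lemma exists_maximal_subweights [Finite ι] (hw : 0 ≤ w) (hy : 0 ≤ y) :
    ∃ a : κ → ℝ, 0 ≤ a ∧ a ≤ w ∧ (∀ e, ∑ k, a k * f k e ≤ y e) ∧
      ∀ k, a k < w k → ∃ e, f k e ≠ 0 ∧ ∑ j, a j * f j e = y e := by
  classical
  let P : Set (κ → ℝ) := Set.Icc 0 w ∩ {a | ∀ e, ∑ k, a k * f k e ≤ y e}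
  have hP : IsCompact P := isCompact_Icc.inter_right <| by
    simp only [Set.ofPred_forall]
    exact isClosed_iInter fun e => isClosed_le (by fun_prop) continuous_const
  obtain ⟨a, ⟨⟨ha0, haw⟩, hay⟩, hmax⟩ := hP.exists_isMaxOn
    ⟨0, ⟨le_rfl, hw⟩, fun e => by simpa using hy e⟩
    (f := fun a => ∑ k, a k) (by fun_prop)
  refine ⟨a, ha0, haw, hay, fun k hk => ?_⟩
  by_contra! hslack
  have hsum (ε : ℝ) (e : ι) : ∑ j, (a + Pi.single k ε : κ → ℝ) j * f j e =
      ∑ j, a j * f j e + ε * f k e := by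
    simp [add_mul, Finset.sum_add_distrib, Pi.single_apply]
  have hfeasible : ∀ᶠ ε in 𝓝[>] (0 : ℝ),
      ∀ e, ∑ j, a j * f j e + ε * f k e ≤ y e := by
    refine nhdsWithin_le_nhds (Filter.eventually_all.2 fun e => ?_)
    by_cases hfe : f k e = 0
    · simp [hfe, hay e]
    · have hcont : Continuous fun ε : ℝ => ∑ j, a j * f j e + ε * f k e := by fun_prop
      refine (hcont.tendsto 0).eventually_le_const ?_
      simpa using (hay e).lt_of_ne (hslack e hfe)
  obtain ⟨ε, hεy, hε0 : 0 < ε, hεw⟩ :=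
    (hfeasible.and (Ioc_mem_nhdsGT (sub_pos.2 hk))).exists
  have hmem : a + Pi.single k ε ∈ P := by
    refine ⟨⟨add_nonneg ha0 (Pi.single_nonneg.2 hε0.le), fun j => ?_⟩,
      fun e => (hsum ε e).trans_le (hεy e)⟩
    rcases eq_or_ne j k with rfl | hj
    · simpa using le_sub_iff_add_le'.1 hεw
    · simpa [hj] using haw j
  have hle : ∑ j, (a + Pi.single k ε : κ → ℝ) j ≤ ∑ j, a j := hmax hmem
  simp only [Pi.add_apply, Finset.sum_add_distrib, Fintype.sum_pi_single'] at hle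
  linarith

lemma sum_sub_le_sum_abs_of_tight [Fintype ι] {a : κ → ℝ} (haw : a ≤ w) (hf : 0 ≤ f)
    (htight : ∀ k, a k < w k → ∃ e, 1 ≤ f k e ∧ ∑ j, a j * f j e = y e) :
    ∑ k, (w k - a k) ≤ ∑ e, |y e - ∑ k, w k * f k e| := by
  classical
  let T : Finset ι := {e | ∑ k, a k * f k e = y e}
  have hcover (k : κ) : w k - a k ≤ ∑ e ∈ T, (w k - a k) * f k e := by
    have hgap : 0 ≤ w k - a k := sub_nonneg.2 (haw k)
    have hnonneg : ∀ e ∈ T, 0 ≤ (w k - a k) * f k e := fun e _ => mul_nonneg hgap (hf k e)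
    rcases hgap.eq_or_lt with h | h
    · rw [← h]; simp
    · obtain ⟨e, hfe, he⟩ := htight k (sub_pos.1 h)
      exact (le_mul_of_one_le_right hgap hfe).trans
        (Finset.single_le_sum hnonneg (Finset.mem_filter.2 ⟨Finset.mem_univ e, he⟩))
  calc ∑ k, (w k - a k) ≤ ∑ k, ∑ e ∈ T, (w k - a k) * f k e :=
        Finset.sum_le_sum fun k _ => hcover k
    _ = ∑ e ∈ T, (∑ k, w k * f k e - y e) := by
        rw [Finset.sum_comm]
        refine Finset.sum_congr rfl fun e he => ?_
        simp only [sub_mul, Finset.sum_sub_distrib, (Finset.mem_filter.1 he).2]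
    _ ≤ ∑ e ∈ T, |y e - ∑ k, w k * f k e| :=
        Finset.sum_le_sum fun e _ => by rw [abs_sub_comm]; exact le_abs_self _
    _ ≤ ∑ e, |y e - ∑ k, w k * f k e| :=
        Finset.sum_le_univ_sum_of_nonneg fun _ => abs_nonneg _

end MaximalSubweights

section StandardForm

variable {ι : Type*} [Fintype ι]

lemma sum_abs_le_sqrt_card_mul_norm (x : EuclideanSpace ℝ ι) :
    ∑ e, |x e| ≤ √(Fintype.card ι) * ‖x‖ := by
  rw [EuclideanSpace.norm_eq, ← Real.sqrt_mul (Nat.cast_nonneg _)]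
  refine Real.le_sqrt_of_sq_le ?_
  simpa using sq_sum_le_card_mul_sum_sq (s := Finset.univ) (f := fun e => |x e|)

/-- A polyhedron in the standard form of linear programming: the intersection of an affine subspace
with the nonnegative orthant. The linear equations are encoded by the affine subspace they define,
so that passing to a face only shrinks the subspace. -/
def IsStandardForm (C : Set (EuclideanSpace ℝ ι)) : Prop :=
  ∃ F : AffineSubspace ℝ (EuclideanSpace ℝ ι), C = {x | x ∈ F ∧ ∀ e, 0 ≤ x e}

namespace IsStandardForm

variable {C K : Set (EuclideanSpace ℝ ι)} {x y : EuclideanSpace ℝ ι}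

lemma nonneg (hC : IsStandardForm C) (hx : x ∈ C) (e : ι) : 0 ≤ x e := by
  obtain ⟨F, rfl⟩ := hC
  exact hx.2 e

lemma convex (hC : IsStandardForm C) : Convex ℝ C := by
  obtain ⟨F, rfl⟩ := hC
  intro x hx y hy s t hs ht hst
  exact ⟨F.convex hx.1 hy.1 hs ht hst, fun e => by
    simpa using add_nonneg (mul_nonneg hs (hx.2 e)) (mul_nonneg ht (hy.2 e))⟩

lemma of_isExposed (hC : IsStandardForm C) (hK : IsExposed ℝ C K) : IsStandardForm K := by
  obtain ⟨F, rfl⟩ := hC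
  rcases K.eq_empty_or_nonempty with rfl | ⟨p, hp⟩
  · exact ⟨⊥, Set.ext fun z => by simp [AffineSubspace.notMem_bot]⟩
  obtain ⟨l, rfl⟩ := hK ⟨p, hp⟩
  refine ⟨F ⊓ AffineSubspace.mk' p l.toLinearMap.ker, Set.ext fun z => ?_⟩
  have hmem : z ∈ F ⊓ AffineSubspace.mk' p l.toLinearMap.ker ↔ z ∈ F ∧ l z = l p := by
    simp [AffineSubspace.mem_inf_iff, AffineSubspace.mem_mk', sub_eq_zero]
  constructor
  · rintro ⟨hz, hmax⟩
    exact ⟨hmem.2 ⟨hz.1, (hp.2 z hz).antisymm (hmax p hp.1)⟩, hz.2⟩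
  · rintro ⟨hz, hz0⟩
    obtain ⟨hzF, hlz⟩ := hmem.1 hz
    exact ⟨⟨hzF, hz0⟩, fun u hu => (hp.2 u hu).trans hlz.ge⟩

lemma eq_of_le (hC : IsStandardForm C) (hCb : Bornology.IsBounded C) (hx : x ∈ C) (hy : y ∈ C)
    (hxy : ∀ e, x e ≤ y e) : x = y := by
  obtain ⟨F, rfl⟩ := hC
  obtain ⟨R, hR⟩ := Metric.isBounded_iff.1 hCb
  by_contra hne
  have hpos : 0 < ‖y - x‖ := norm_pos_iff.2 (sub_ne_zero.2 (Ne.symm hne))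
  have hR0 : 0 ≤ R := dist_nonneg.trans (hR hx hy)
  -- The whole ray from `y` in the direction `y - x ≥ 0` lies in the polyhedron.
  let z := ((R + 1) / ‖y - x‖) • (y - x) + y
  have hz : z ∈ F ∧ ∀ e, 0 ≤ z e := by
    refine ⟨AffineSubspace.smul_vsub_vadd_mem F _ hy.1 hx.1 hy.1, fun e => ?_⟩
    have hscale : 0 ≤ (R + 1) / ‖y - x‖ := by positivity
    simpa [z] using add_nonneg (mul_nonneg hscale (sub_nonneg.2 (hxy e))) (hy.2 e)
  have hdist : dist z y = R + 1 := by
    rw [dist_eq_norm, add_sub_cancel_right, norm_smul_of_nonneg (by positivity),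
      div_mul_cancel₀ _ hpos.ne']
  linarith [hR hz hy]

variable {κ : Type*} [Fintype κ] {p : κ → EuclideanSpace ℝ ι}

lemma exists_smul_eq_sub_sum (hC : IsStandardForm C) (hp : ∀ k, p k ∈ C) {a : κ → ℝ}
    (ha : ∑ k, a k < 1) (hy : y ∈ C) (hay : ∀ e, ∑ k, a k * p k e ≤ y e) :
    ∃ z ∈ C, (1 - ∑ k, a k) • z = y - ∑ k, a k • p k := by
  obtain ⟨F, rfl⟩ := hC
  set δ := 1 - ∑ k, a k with hδ
  have hδ0 : 0 < δ := sub_pos.2 ha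
  let z := δ⁻¹ • ∑ k, a k • (y - p k) + y
  have hz : δ • z = y - ∑ k, a k • p k := by
    rw [smul_add, smul_inv_smul₀ hδ0.ne', hδ]
    simp only [smul_sub, Finset.sum_sub_distrib, ← Finset.sum_smul, sub_smul, one_smul]
    abel
  have hzF : z ∈ F := AffineSubspace.vadd_mem_of_mem_direction
    (F.direction.smul_mem _ <| F.direction.sum_mem fun k _ =>
      F.direction.smul_mem _ <| F.vsub_mem_direction hy.1 (hp k).1) hy.1
  refine ⟨z, ⟨hzF, fun e => nonneg_of_mul_nonneg_right (a := δ) ?_ hδ0⟩, hz⟩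
  have hze : δ * z e = y e - ∑ k, a k * p k e := by simpa using congrArg (fun u => u e) hz
  exact hze ▸ sub_nonneg.2 (hay e)

lemma exists_sub_eq_sum_smul_sub (hC : IsStandardForm C) (hCb : Bornology.IsBounded C)
    (hp : ∀ k, p k ∈ C) (hp1 : ∀ k e, p k e = 0 ∨ 1 ≤ p k e) {w : κ → ℝ} (hw : 0 ≤ w)
    (hw1 : ∑ k, w k = 1) (hx : ∑ k, w k • p k = x) (hy : y ∈ C) (hxy : x ≠ y) :
    ∃ z ∈ C, ∃ c : κ → ℝ, 0 ≤ c ∧ ∑ k, c k ≤ √(Fintype.card ι) * ‖y - x‖ ∧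
      y - x = ∑ k, c k • (z - p k) := by
  obtain ⟨a, -, haw, hay, htight⟩ :=
    exists_maximal_subweights (f := fun k e => p k e) hw (hC.nonneg hy)
  have hx_apply (e : ι) : x e = ∑ k, w k * p k e := by simp [← hx]
  have ha1 : ∑ k, a k < 1 := by
    refine (hw1 ▸ Finset.sum_le_sum fun k _ => haw k).lt_of_ne fun h => hxy ?_
    have hmass := (Finset.sum_eq_sum_iff_of_le fun k _ => haw k).1 (h.trans hw1.symm)
    have hxC : x ∈ C := hx ▸ hC.convex.sum_mem (fun k _ => hw k) hw1 fun k _ => hp k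
    refine hC.eq_of_le hCb hxC hy fun e => ?_
    simpa only [hx_apply, hmass _ (Finset.mem_univ _)] using hay e
  obtain ⟨z, hzC, hz⟩ := hC.exists_smul_eq_sub_sum hp ha1 hy hay
  refine ⟨z, hzC, w - a, sub_nonneg.2 haw, ?_, ?_⟩
  · calc ∑ k, (w k - a k) ≤ ∑ e, |y e - ∑ k, w k * p k e| :=
          sum_sub_le_sum_abs_of_tight haw (fun k e => hC.nonneg (hp k) e) fun k hk => by
            obtain ⟨e, hne, he⟩ := htight k hk
            exact ⟨e, (hp1 k e).resolve_left hne, he⟩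
      _ = ∑ e, |(y - x) e| := by simp only [PiLp.sub_apply, hx_apply]
      _ ≤ √(Fintype.card ι) * ‖y - x‖ := sum_abs_le_sqrt_card_mul_norm _
  · calc y - x = (1 - ∑ k, a k) • z + ∑ k, a k • p k - x := by rw [hz, sub_add_cancel]
      _ = ∑ k, (w k - a k) • (z - p k) := by
          simp only [smul_sub, Finset.sum_sub_distrib, ← Finset.sum_smul, sub_smul, hw1, hx]
          abel

lemma exists_norm_sub_le_sqrt_card_mul_inner (hC : IsStandardForm C)
    (hCb : Bornology.IsBounded C) {S : Finset (EuclideanSpace ℝ ι)} (hSC : (S : Set _) ⊆ C)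
    (hS1 : ∀ v ∈ S, ∀ e, v e = 0 ∨ 1 ≤ v e) (hx : IsProperConvexComb S x) (hy : y ∈ C)
    (hxy : x ≠ y) :
    ∃ z ∈ C, ∃ v ∈ S, ‖y - x‖ ≤ √(Fintype.card ι) * inner ℝ (y - x) (z - v) := by
  obtain ⟨w, hw, hw1, hwx⟩ := hx
  obtain ⟨z, hz, c, hc, hcle, hyx⟩ := hC.exists_sub_eq_sum_smul_sub hCb
    (p := ((↑) : S → EuclideanSpace ℝ ι)) (fun v => hSC v.2) (fun v => hS1 v v.2)
    (w := fun v => w v) (fun v => (hw v v.2).le)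
    ((Finset.sum_coe_sort S w).trans hw1)
    ((Finset.sum_coe_sort S fun v => w v • v).trans hwx) hy hxy
  have hS : S.Nonempty := Finset.nonempty_of_sum_ne_zero (hw1.trans_ne one_ne_zero)
  obtain ⟨v, hv, hmin⟩ := S.exists_min_image (fun v => inner ℝ (y - x) v) hS
  refine ⟨z, hz, v, hv, ?_⟩
  have hpos : 0 < ‖y - x‖ := norm_pos_iff.2 (sub_ne_zero.2 hxy.symm)
  have hsq : ‖y - x‖ * ‖y - x‖ ≤ (∑ u, c u) * inner ℝ (y - x) (z - v) := by
    calc ‖y - x‖ * ‖y - x‖ = ∑ u, c u * inner ℝ (y - x) (z - u) := by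
          rw [← real_inner_self_eq_norm_mul_norm]
          nth_rewrite 2 [hyx]
          simp only [inner_sum, real_inner_smul_right]
      _ ≤ ∑ u, c u * inner ℝ (y - x) (z - v) := Finset.sum_le_sum fun u _ => by
          refine mul_le_mul_of_nonneg_left ?_ (hc u)
          simpa only [inner_sub_right] using sub_le_sub_left (hmin u u.2) _
      _ = (∑ u, c u) * inner ℝ (y - x) (z - v) := (Finset.sum_mul ..).symm
  have hinner : 0 < inner ℝ (y - x) (z - v) :=
    pos_of_mul_pos_right ((mul_pos hpos hpos).trans_le hsq) (Finset.sum_nonneg fun u _ => hc u)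
  refine le_of_mul_le_mul_right ?_ hpos
  calc ‖y - x‖ * ‖y - x‖ ≤ √(Fintype.card ι) * ‖y - x‖ * inner ℝ (y - x) (z - v) :=
        hsq.trans (mul_le_mul_of_nonneg_right hcle hinner.le)
    _ = √(Fintype.card ι) * inner ℝ (y - x) (z - v) * ‖y - x‖ := by ring

end IsStandardForm

theorem one_div_sqrt_card_le_pyramidalWidth {A : Set (EuclideanSpace ℝ ι)} (hA : A.Finite)
    (hA' : A.Nontrivial) (hA1 : ∀ v ∈ A, ∀ e, v e = 0 ∨ 1 ≤ v e)
    (hC : IsStandardForm (convexHull ℝ A)) :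
    1 / √(Fintype.card ι) ≤ pyramidalWidth A := by
  refine le_pyramidalWidth hA' fun K hK x _ y hy hxy S hS hSx => ?_
  obtain ⟨z, hz, v, hv, hle⟩ := (hC.of_isExposed hK).exists_norm_sub_le_sqrt_card_mul_inner
    ((isBounded_convexHull.2 hA.isBounded).subset hK.subset)
    (hS.trans Set.inter_subset_left) (fun v hv => hA1 v (hS hv).2) hSx hy hxy
  have hwidth := inner_sub_le_norm_mul_pyramidDirWidth (hA.subset Set.inter_subset_right)
    (subset_convexHull_inter_of_isExposed hK hz) hv (y - x)
  have hpos : 0 < ‖y - x‖ := norm_pos_iff.2 (sub_ne_zero.2 hxy.symm)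
  have hsqrt : 0 < √(Fintype.card ι) := (Real.sqrt_nonneg _).lt_of_ne' fun h => by
    rw [h, zero_mul] at hle
    exact hle.not_gt hpos
  rw [div_le_iff₀' hsqrt]
  refine le_of_mul_le_mul_left ?_ hpos
  calc ‖y - x‖ * 1 ≤ √(Fintype.card ι) * (‖y - x‖ * pyramidDirWidth (K ∩ A) S (y - x)) := by
        rw [mul_one]
        exact hle.trans (mul_le_mul_of_nonneg_left hwidth (Real.sqrt_nonneg _))
    _ = ‖y - x‖ * (√(Fintype.card ι) * pyramidDirWidth (K ∩ A) S (y - x)) := mul_left_comm ..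

end StandardForm

section Birkhoff

variable {n : ℕ}

lemma isLinearMap_vectorize : IsLinearMap ℝ (vectorize (n := n)) :=
  ⟨fun _ _ => rfl, fun _ _ => rfl⟩

lemma convexHull_permVectors (n : ℕ) : convexHull ℝ (permVectors n) = birkhoffPolytope n := by
  rw [birkhoffPolytope, doublyStochastic_eq_convexHull_permMatrix,
    isLinearMap_vectorize.image_convexHull, ← Set.range, ← Set.range_comp]
  rfl

lemma mem_birkhoffPolytope_iff {x : EuclideanSpace ℝ (Fin n × Fin n)} :
    x ∈ birkhoffPolytope n ↔
      (∀ e, 0 ≤ x e) ∧ (∀ i, ∑ j, x (i, j) = 1) ∧ ∀ j, ∑ i, x (i, j) = 1 := by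
  constructor
  · rintro ⟨M, hM, rfl⟩
    obtain ⟨hnonneg, hrow, hcol⟩ := mem_doublyStochastic_iff_sum.1 hM
    exact ⟨fun e => hnonneg e.1 e.2, hrow, hcol⟩
  · rintro ⟨hnonneg, hrow, hcol⟩
    exact ⟨Matrix.of fun i j => x (i, j),
      mem_doublyStochastic_iff_sum.2 ⟨fun i j => hnonneg (i, j), hrow, hcol⟩, rfl⟩

lemma isStandardForm_birkhoffPolytope (n : ℕ) : IsStandardForm (birkhoffPolytope n) := by
  let F : AffineSubspace ℝ (EuclideanSpace ℝ (Fin n × Fin n)) :=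
    { carrier := {x | (∀ i, ∑ j, x (i, j) = 1) ∧ ∀ j, ∑ i, x (i, j) = 1}
      smul_vsub_vadd_mem' := by
        rintro c p q r ⟨hp, hp'⟩ ⟨hq, hq'⟩ ⟨hr, hr'⟩
        simp [Finset.sum_add_distrib, ← Finset.mul_sum, hp, hp', hq, hq', hr, hr'] }
  exact ⟨F, Set.ext fun x => mem_birkhoffPolytope_iff.trans and_comm⟩

lemma vectorize_permMatrix_apply (σ : Equiv.Perm (Fin n)) (i j : Fin n) :
    vectorize (σ.permMatrix ℝ) (i, j) = if σ i = j then 1 else 0 := by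
  simp [vectorize, Equiv.Perm.permMatrix, PEquiv.toMatrix_apply, eq_comm]

lemma eq_zero_or_one_of_mem_permVectors {v : EuclideanSpace ℝ (Fin n × Fin n)}
    (hv : v ∈ permVectors n) (e : Fin n × Fin n) : v e = 0 ∨ v e = 1 := by
  obtain ⟨σ, rfl⟩ := hv
  exact (ite_eq_or_eq _ _ _).symm.imp (vectorize_permMatrix_apply σ e.1 e.2).trans
    (vectorize_permMatrix_apply σ e.1 e.2).trans

lemma dist_vectorize_permMatrix (σ τ : Equiv.Perm (Fin n)) :
    dist (vectorize (σ.permMatrix ℝ)) (vectorize (τ.permMatrix ℝ)) =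
      √(2 * hammingDist (σ : Fin n → Fin n) τ) := by
  have hrow (i : Fin n) : ∑ j, ((if σ i = j then (1 : ℝ) else 0) - if τ i = j then 1 else 0) ^ 2 =
      if σ i ≠ τ i then 2 else 0 := by
    by_cases h : σ i = τ i
    · simp [h]
    · norm_num [sub_sq, Finset.sum_add_distrib, Finset.sum_sub_distrib, h]
  rw [EuclideanSpace.dist_eq, Fintype.sum_prod_type]
  simp only [Real.dist_eq, sq_abs, vectorize_permMatrix_apply, hrow, hammingDist,
    ← Finset.sum_filter, Finset.sum_const, nsmul_eq_mul, mul_comm]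

lemma exists_perm_forall_ne (hn : 2 ≤ n) : ∃ σ : Equiv.Perm (Fin n), ∀ i, σ i ≠ i := by
  obtain ⟨m, rfl⟩ := Nat.exists_eq_add_of_le' hn
  exact ⟨Equiv.addRight 1, fun i => by simp⟩

lemma finite_permVectors (n : ℕ) : (permVectors n).Finite := Set.finite_range _

lemma diam_permVectors (hn : 2 ≤ n) : Metric.diam (permVectors n) = √(2 * n) := by
  refine le_antisymm (Metric.diam_le_of_forall_dist_le (Real.sqrt_nonneg _) ?_) ?_
  · rintro _ ⟨σ, rfl⟩ _ ⟨τ, rfl⟩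
    rw [dist_vectorize_permMatrix]
    gcongr
    simpa using hammingDist_le_card_fintype (x := (σ : Fin n → Fin n)) (y := τ)
  · obtain ⟨σ, hσ⟩ := exists_perm_forall_ne hn
    have hfar : hammingDist (σ : Fin n → Fin n) (1 : Equiv.Perm (Fin n)) = n := by
      simp [hammingDist, hσ]
    have hdist := dist_vectorize_permMatrix σ 1
    rw [hfar] at hdist
    rw [← hdist]
    exact Metric.dist_le_diam_of_mem (finite_permVectors n).isBounded ⟨σ, rfl⟩ ⟨1, rfl⟩

theorem diam_birkhoffPolytope (hn : 2 ≤ n) : Metric.diam (birkhoffPolytope n) = √(2 * n) := by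
  rw [← convexHull_permVectors, convexHull_diam, diam_permVectors hn]

lemma nontrivial_permVectors (hn : 2 ≤ n) : (permVectors n).Nontrivial := by
  by_contra h
  have hdiam := diam_permVectors hn
  rw [Metric.diam_subsingleton (Set.not_nontrivial_iff.1 h)] at hdiam
  have : 0 < √(2 * (n : ℝ)) := by positivity
  exact this.ne hdiam

theorem one_div_le_pyramidalWidth_permVectors (hn : 2 ≤ n) :
    1 / (n : ℝ) ≤ pyramidalWidth (permVectors n) := by
  have hC : IsStandardForm (convexHull ℝ (permVectors n)) :=
    convexHull_permVectors n ▸ isStandardForm_birkhoffPolytope n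
  simpa using one_div_sqrt_card_le_pyramidalWidth (finite_permVectors n)
    (nontrivial_permVectors hn)
    (fun v hv e => (eq_zero_or_one_of_mem_permVectors hv e).imp_right ge_of_eq) hC

end Birkhoff

end BirkhoffEcc

theorem mainTheorem6 (n : ℕ) (hn : 2 ≤ n) :
    Metric.diam (BirkhoffEcc.birkhoffPolytope n) = Real.sqrt (2 * (n : ℝ)) ∧
    1 / (n : ℝ) ≤ BirkhoffEcc.pyramidalWidth (BirkhoffEcc.permVectors n) ∧
    1 / (2 * (n : ℝ) ^ 3) ≤
      (BirkhoffEcc.pyramidalWidth (BirkhoffEcc.permVectors n) /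
        Metric.diam (BirkhoffEcc.birkhoffPolytope n)) ^ 2 := by
  have hdiam := BirkhoffEcc.diam_birkhoffPolytope hn
  have hwidth := BirkhoffEcc.one_div_le_pyramidalWidth_permVectors hn
  refine ⟨hdiam, hwidth, ?_⟩
  have : (0 : ℝ) < n := by positivity
  calc 1 / (2 * (n : ℝ) ^ 3) = (1 / n / √(2 * n)) ^ 2 := by
        rw [div_pow, Real.sq_sqrt (by positivity)]
        field_simp
    _ ≤ _ := by
        rw [hdiam]
        gcongr
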